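/- **Lemma (Quant: the mixing morphisms are exactly the simple mixing maps).** For morphisms $f,g$ of a symmetric monoidal category write $f\oslash g$ if for all objects $A,B$ the morphism $f\otimes\mathrm{id}_A$ has the left lifting property with respect to $g\otimes\mathrm{id}_B$, i.e. for every commuting square $(g\otimes\mathrm{id}_B)\circ a=b\circ(f\otimes\mathrm{id}_A)$ there is a morphism $h$ with $h\circ(f\otimes\mathrm{id}_A)=a$ and $(g\otimes\mathrm{id}_B)\circ h=b$. Let $\mathbf{Quant}$ be the symmetric monoidal category whose objects are the nonzero finite-dimensional complex Hilbert spaces and whose morphisms $A\to B$ are the completely positive linear maps $B(A)\to B(B)$ (not necessarily trace preserving), with the usual tensor product, whose unit is $I=\mathbb C$. For each object $A$ let the completely mixed state $\mu_A\colon I\to A$ be the completely positive map $B(\mathbb C)=\mathbb C\to B(A)$ with $1\mapsto \mathrm{id}_A$. Call a morphism $g$ pure if $\mu_C\oslash g$ for every object $C$, let $\mathcal P$ be the class of pure morphisms, and let the class of mixing morphisms be $$\mathcal M=\{f\mid f\oslash g\text{ for all }g\in\mathcal P\}.$$ Then $\mathcal M$ consists of exactly the simple mixing maps: a morphism $m\colon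 A\to B$ of $\mathbf{Quant}$ is in $\mathcal M$ if and only if there are an object $C$ and an isomorphism $p\colon A\otimes C\to B$ in $\mathbf{Quant}$ with $$m=p\circ(\mathrm{id}_A\otimes\mu_C)$$ (where $A$ is identified with $A\otimes I$). -/

import Mathlib

open CategoryTheory MonoidalCategory
open scoped TensorProduct InnerProductSpace CStarAlgebra ComplexOrder

namespace CStarMatrix

theorem nonneg_iff_star_mul_self_aux {B : Type*} [NonUnitalCStarAlgebra B] [PartialOrder B]
    [StarOrderedRing B] (a : B) : 0 ≤ a ↔ ∃ b, a = star b * b :=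
  CStarAlgebra.nonneg_iff_eq_star_mul_self

theorem exists_negPart_aux {B : Type*} [NonUnitalCStarAlgebra B] [PartialOrder B]
    [StarOrderedRing B] (a : B) (ha : star a = a) :
    ∃ N b : B, star N * a * N = -(star b * b) ∧ (b = 0 → 0 ≤ a) := by
  have hN0 : 0 ≤ a⁻ := CFC.negPart_nonneg a
  have hNs : star a⁻ = a⁻ := hN0.isSelfAdjoint
  have h3 : 0 ≤ a⁻ * a⁻ * a⁻ := by
    have := star_left_conjugate_nonneg hN0 a⁻
    rwa [hNs] at this
  obtain ⟨b, hb⟩ := CStarAlgebra.nonneg_iff_eq_star_mul_self.mp h3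
  refine ⟨a⁻, b, ?_, ?_⟩
  · rw [hNs, ← hb]
    have h1 : a⁻ * a = -(a⁻ * a⁻) := by
      calc a⁻ * a = a⁻ * (a⁺ - a⁻) := by rw [CFC.posPart_sub_negPart a ha]
        _ = -(a⁻ * a⁻) := by rw [mul_sub, CFC.negPart_mul_posPart, zero_sub]
    rw [h1, neg_mul]
  · intro h0
    rw [h0, mul_zero] at hb
    rw [← CFC.negPart_eq_zero_iff a ha]
    have h2 : a⁻ * a⁻ = 0 := by
      rw [← CStarRing.star_mul_self_eq_zero_iff, star_mul, hNs, ← mul_assoc, hb, zero_mul]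
    rw [← CStarRing.star_mul_self_eq_zero_iff, hNs, h2]

variable {H : Type*} [NormedAddCommGroup H] [InnerProductSpace ℂ H]
variable {n : Type*} [Fintype n]

/-- The action of a square matrix of operators on column vectors. -/
def opAct (M : CStarMatrix n n (H →L[ℂ] H)) (x : n → H) : n → H := fun i => ∑ j, M i j (x j)

theorem opAct_mul (M N : CStarMatrix n n (H →L[ℂ] H)) (x : n → H) :
    opAct (M * N) x = opAct M (opAct N x) := by
  funext i
  simp only [opAct, CStarMatrix.mul_apply, sum_apply, mul_apply_eq_comp, map_sum]
  exact Finset.sum_comm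

theorem opAct_injective {M : CStarMatrix n n (H →L[ℂ] H)} (h : ∀ x, opAct M x = 0) : M = 0 := by
  classical
  ext i j v
  have := congrFun (h (Pi.single j v)) i
  rw [opAct, Finset.sum_eq_single j] at this
  · simpa using this
  · intro b _ hb
    simp [Pi.single_eq_of_ne hb]
  · simp

theorem eq_zero_of_sum_inner_opAct {M : CStarMatrix n n (H →L[ℂ] H)}
    (h : ∀ x : n → H, ∑ i, ⟪x i, opAct M x i⟫_ℂ = 0) : M = 0 := by
  let T : PiLp 2 (fun _ : n => H) →ₗ[ℂ] PiLp 2 (fun _ : n => H) :=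
    { toFun := fun x => WithLp.toLp 2 (opAct M x)
      map_add' := fun x y => by
        ext i; simp [opAct, Finset.sum_add_distrib]
      map_smul' := fun c x => by
        ext i; simp [opAct, Finset.smul_sum] }
  have hT : T = 0 := by
    rw [← inner_map_self_eq_zero]
    intro x
    rw [← inner_conj_symm, PiLp.inner_apply]
    exact (congrArg _ (h x.ofLp)).trans (map_zero _)
  refine opAct_injective fun x => ?_
  have := congrArg (fun S => WithLp.ofLp (S (WithLp.toLp 2 x))) hT
  simpa [T] using this

variable [CompleteSpace H]

theorem sum_inner_opAct_star (N : CStarMatrix n n (H →L[ℂ] H)) (x y : n → H) :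
    ∑ i, ⟪x i, opAct (star N) y i⟫_ℂ = ∑ i, ⟪opAct N x i, y i⟫_ℂ := by
  simp only [opAct, inner_sum, sum_inner, CStarMatrix.star_apply,
    ContinuousLinearMap.star_eq_adjoint, ContinuousLinearMap.adjoint_inner_right]
  exact Finset.sum_comm

/-- A square matrix of operators is positive in the C⋆-algebra of operator matrices exactly when
it is positive as an operator on column vectors. -/
theorem nonneg_iff_sum_inner_opAct (M : CStarMatrix n n (H →L[ℂ] H)) :
    0 ≤ M ↔ ∀ x : n → H, 0 ≤ ∑ i, ⟪x i, opAct M x i⟫_ℂ := by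
  have key : ∀ (b : CStarMatrix n n (H →L[ℂ] H)) (x : n → H),
      ∑ i, ⟪x i, opAct (star b * b) x i⟫_ℂ = ((∑ i, ‖opAct b x i‖ ^ 2 : ℝ) : ℂ) := by
    intro b x
    rw [opAct_mul, sum_inner_opAct_star]
    push_cast
    exact Finset.sum_congr rfl fun i _ => by
      rw [inner_self_eq_norm_sq_to_K]; rfl
  refine ⟨fun hM x => ?_, fun h => ?_⟩
  · obtain ⟨b, rfl⟩ := (nonneg_iff_star_mul_self_aux M).mp hM
    rw [key]
    exact_mod_cast Finset.sum_nonneg fun i _ => by positivity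
  have hsa : star M = M := by
    rw [← sub_eq_zero]
    refine eq_zero_of_sum_inner_opAct fun x => ?_
    have e : ∀ i, opAct (star M - M) x i = opAct (star M) x i - opAct M x i := by
      intro i; simp [opAct, Finset.sum_sub_distrib]
    simp only [e, inner_sub_right, Finset.sum_sub_distrib]
    rw [sum_inner_opAct_star, sub_eq_zero]
    have hr : (starRingEnd ℂ) (∑ i, ⟪x i, opAct M x i⟫_ℂ) = ∑ i, ⟪x i, opAct M x i⟫_ℂ :=
      Complex.conj_eq_iff_im.mpr (Complex.nonneg_iff.mp (h x)).2.symm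
    rw [← hr, map_sum]
    simp only [inner_conj_symm]
  obtain ⟨N, b, hNb, hb⟩ := exists_negPart_aux M hsa
  refine hb (opAct_injective fun x => ?_)
  have h4 := h (opAct N x)
  have e2 : ∑ i, ⟪opAct N x i, opAct M (opAct N x) i⟫_ℂ
      = -((∑ i, ‖opAct b x i‖ ^ 2 : ℝ) : ℂ) := by
    rw [← key, ← sum_inner_opAct_star, ← opAct_mul, ← opAct_mul, hNb]
    simp [opAct, inner_sum]
  rw [e2] at h4
  have h5 : (∑ i, ‖opAct b x i‖ ^ 2 : ℝ) ≤ 0 := by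
    have : (0 : ℝ) ≤ -(∑ i, ‖opAct b x i‖ ^ 2 : ℝ) := by exact_mod_cast h4
    linarith
  have h6 := (Finset.sum_eq_zero_iff_of_nonneg (fun i _ => by positivity)).mp
    (le_antisymm h5 (Finset.sum_nonneg fun i _ => by positivity))
  funext i
  simpa using h6 i (Finset.mem_univ i)

theorem nonneg_iff_sum_inner (M : CStarMatrix n n (H →L[ℂ] H)) :
    0 ≤ M ↔ ∀ x : n → H, 0 ≤ ∑ i, ∑ j, ⟪x i, M i j (x j)⟫_ℂ := by
  simp only [nonneg_iff_sum_inner_opAct, opAct, inner_sum]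

end CStarMatrix

/-- Objects of the category of quantum systems: nonzero finite-dimensional complex Hilbert
spaces (the zero space is excluded, since it has no nonzero state). -/
structure Quant where
  /-- the underlying Hilbert space -/
  carrier : Type
  [normedAddCommGroup : NormedAddCommGroup carrier]
  [innerProductSpace : InnerProductSpace ℂ carrier]
  [finiteDimensional : FiniteDimensional ℂ carrier]
  [nontrivial : Nontrivial carrier]

namespace Quant

instance : CoeSort Quant Type := ⟨carrier⟩

attribute [instance] normedAddCommGroup innerProductSpace finiteDimensional nontrivial

instance (A : Quant) : CompleteSpace A := FiniteDimensional.complete ℂ A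

/-- The algebra `B(A)` of operators on the Hilbert space `A`. -/
abbrev Op (A : Quant) : Type := A →L[ℂ] A

/-- Morphisms are the completely positive maps `B(A) → B(B)`; they need not preserve the trace. -/
@[ext]
structure Hom (A B : Quant) where
  /-- the underlying completely positive map -/
  cp : A.Op →CP B.Op

/-- Build a morphism from a linear map with a proof of complete positivity. -/
def Hom.ofLinear {A B : Quant} (Φ : A.Op →ₗ[ℂ] B.Op)
    (h : ∀ (k : ℕ) (M : CStarMatrix (Fin k) (Fin k) A.Op), 0 ≤ M → 0 ≤ M.map Φ) : Hom A B :=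
  ⟨{ Φ with map_cstarMatrix_nonneg' := h }⟩

/-- The underlying linear map of a morphism. -/
def Hom.lin {A B : Quant} (f : Hom A B) : A.Op →ₗ[ℂ] B.Op := f.cp.toLinearMap

@[simp] theorem Hom.lin_ofLinear {A B : Quant} (Φ : A.Op →ₗ[ℂ] B.Op) (h) :
    (Hom.ofLinear Φ h).lin = Φ := rfl

theorem Hom.lin_injective {A B : Quant} {f g : Hom A B} (h : f.lin = g.lin) : f = g := by
  obtain ⟨⟨f, hf⟩⟩ := f
  obtain ⟨⟨g, hg⟩⟩ := g
  obtain rfl : f = g := h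
  rfl

theorem Hom.nonneg {A B : Quant} (f : Hom A B) {n : Type*} [Fintype n]
    (M : CStarMatrix n n A.Op) (hM : 0 ≤ M) : 0 ≤ M.map f.lin :=
  f.cp.map_cstarMatrix_nonneg M hM

instance : Category Quant where
  Hom := Hom
  id A := Hom.ofLinear LinearMap.id fun _ _ h => h
  comp f g := Hom.ofLinear (g.lin ∘ₗ f.lin) fun _ _ h => g.nonneg _ (f.nonneg _ h)

/-- The underlying linear map `B(A) → B(B)` of a morphism `A ⟶ B`. -/
abbrev linMap {A B : Quant} (f : A ⟶ B) : A.Op →ₗ[ℂ] B.Op := Hom.lin f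

@[ext] theorem hom_ext {A B : Quant} {f g : A ⟶ B} (h : linMap f = linMap g) : f = g :=
  Hom.lin_injective h

@[simp] theorem linMap_id (A : Quant) : linMap (𝟙 A) = LinearMap.id := rfl

@[simp] theorem linMap_comp {A B C : Quant} (f : A ⟶ B) (g : B ⟶ C) :
    linMap (f ≫ g) = linMap g ∘ₗ linMap f := rfl

/-- A ⋆-homomorphism of operator algebras, as a morphism. -/
noncomputable def ofStarHom {A B : Quant} (φ : A.Op →⋆ₙₐ[ℂ] B.Op) : A ⟶ B :=
  Hom.ofLinear (φ : A.Op →ₗ[ℂ] B.Op) fun k M hM =>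
    CompletelyPositiveMapClass.map_cstarMatrix_nonneg' φ k M hM

@[simp] theorem linMap_ofStarHom {A B : Quant} (φ : A.Op →⋆ₙₐ[ℂ] B.Op) (X : A.Op) :
    linMap (ofStarHom φ) X = φ X := rfl

/-- Conjugation `X ↦ u X u⁻¹` by a unitary `u : A → B`, as an isomorphism. -/
noncomputable def conjIso {A B : Quant} (u : A ≃ₗᵢ[ℂ] B) : A ≅ B where
  hom := ofStarHom (NonUnitalStarAlgHomClass.toNonUnitalStarAlgHom u.conjStarAlgEquiv)
  inv := ofStarHom (NonUnitalStarAlgHomClass.toNonUnitalStarAlgHom u.symm.conjStarAlgEquiv)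
  hom_inv_id := by ext X x; simp
  inv_hom_id := by ext X x; simp

@[simp] theorem linMap_conjIso_hom {A B : Quant} (u : A ≃ₗᵢ[ℂ] B) (X : A.Op) :
    linMap (conjIso u).hom X = u.conjStarAlgEquiv X := rfl

@[simp] theorem linMap_conjIso_inv {A B : Quant} (u : A ≃ₗᵢ[ℂ] B) (X : B.Op) :
    linMap (conjIso u).inv X = u.symm.conjStarAlgEquiv X := rfl

/-- The tensor product of Hilbert spaces. -/
noncomputable abbrev tensor (A B : Quant) : Quant := ⟨A ⊗[ℂ] B⟩

/-- The canonical isomorphism `B(A) ⊗ B(B) ≃ B(A ⊗ B)`, sending `S ⊗ T` to the operator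
`S ⊗ T`. -/
noncomputable def opTensorEquiv (A B : Quant) : A.Op ⊗[ℂ] B.Op ≃ₗ[ℂ] (tensor A B).Op :=
  (TensorProduct.congr LinearMap.toContinuousLinearMap.symm
    LinearMap.toContinuousLinearMap.symm).trans
    ((homTensorHomEquiv ℂ A B A B).trans LinearMap.toContinuousLinearMap)

/-- The operator `S ⊗ T` on `A ⊗ B`. -/
noncomputable def tmulOp {A B : Quant} (S : A.Op) (T : B.Op) : (tensor A B).Op :=
  TensorProduct.mapL S T

theorem tmulOp_apply {A B : Quant} (S : A.Op) (T : B.Op) (a : A) (b : B) :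
    tmulOp S T (a ⊗ₜ[ℂ] b) = S a ⊗ₜ[ℂ] T b := rfl

theorem smul_tmulOp {A B : Quant} (c : ℂ) (S : A.Op) (T : B.Op) :
    tmulOp (c • S) T = c • tmulOp S T := TensorProduct.mapL_smul_left _ _ _

theorem tmulOp_smul {A B : Quant} (c : ℂ) (S : A.Op) (T : B.Op) :
    tmulOp S (c • T) = c • tmulOp S T := TensorProduct.mapL_smul_right _ _ _

@[simp] theorem opTensorEquiv_tmul {A B : Quant} (S : A.Op) (T : B.Op) :
    opTensorEquiv A B (S ⊗ₜ T) = tmulOp S T := by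
  refine ContinuousLinearMap.coe_injective (TensorProduct.ext' fun a b => ?_)
  simp [opTensorEquiv, tmulOp]

@[simp] theorem opTensorEquiv_symm_mapL {A B : Quant} (S : A.Op) (T : B.Op) :
    (opTensorEquiv A B).symm (tmulOp S T) = S ⊗ₜ T := by
  rw [LinearEquiv.symm_apply_eq, opTensorEquiv_tmul]

/-- Linear maps out of `B(A ⊗ B)` are determined on the operators `S ⊗ T`. -/
theorem op_ext {A B : Quant} {V : Type*} [AddCommGroup V] [Module ℂ V]
    {f g : (tensor A B).Op →ₗ[ℂ] V}
    (h : ∀ (S : A.Op) (T : B.Op), f (tmulOp S T) = g (tmulOp S T)) :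
    f = g := by
  have : f ∘ₗ (opTensorEquiv A B).toLinearMap = g ∘ₗ (opTensorEquiv A B).toLinearMap :=
    TensorProduct.ext' fun S T => by simpa using h S T
  ext1 X
  simpa using LinearMap.congr_fun this ((opTensorEquiv A B).symm X)

theorem op_ext₃ {A B C : Quant} {V : Type*} [AddCommGroup V] [Module ℂ V]
    {f g : (tensor (tensor A B) C).Op →ₗ[ℂ] V}
    (h : ∀ (S : A.Op) (T : B.Op) (U : C.Op),
      f (tmulOp (tmulOp S T) U)
        = g (tmulOp (tmulOp S T) U)) : f = g := by
  refine op_ext fun X U => ?_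
  have := op_ext (f := f ∘ₗ (opTensorEquiv _ C).toLinearMap ∘ₗ (TensorProduct.mk ℂ _ _).flip U)
    (g := g ∘ₗ (opTensorEquiv _ C).toLinearMap ∘ₗ (TensorProduct.mk ℂ _ _).flip U)
    fun S T => by simpa using h S T U
  simpa using LinearMap.congr_fun this X

theorem op_ext₄ {A B C D : Quant} {V : Type*} [AddCommGroup V] [Module ℂ V]
    {f g : (tensor (tensor (tensor A B) C) D).Op →ₗ[ℂ] V}
    (h : ∀ (S : A.Op) (T : B.Op) (U : C.Op) (W : D.Op),
      f (tmulOp (tmulOp (tmulOp S T) U) W)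
        = g (tmulOp (tmulOp (tmulOp S T) U) W)) : f = g := by
  refine op_ext fun X W => ?_
  have := op_ext₃ (f := f ∘ₗ (opTensorEquiv _ D).toLinearMap ∘ₗ (TensorProduct.mk ℂ _ _).flip W)
    (g := g ∘ₗ (opTensorEquiv _ D).toLinearMap ∘ₗ (TensorProduct.mk ℂ _ _).flip W)
    fun S T U => by simpa using h S T U W
  simpa using LinearMap.congr_fun this X

/-- The tensor product of linear maps `B(A) → B(A')` and `B(B) → B(B')`, characterised by
`S ⊗ T ↦ Φ(S) ⊗ Ψ(T)`. -/
noncomputable def tensorLin {A A' B B' : Quant} (Φ : A.Op →ₗ[ℂ] A'.Op) (Ψ : B.Op →ₗ[ℂ] B'.Op) :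
    (tensor A B).Op →ₗ[ℂ] (tensor A' B').Op :=
  (opTensorEquiv A' B').toLinearMap ∘ₗ TensorProduct.map Φ Ψ ∘ₗ (opTensorEquiv A B).symm.toLinearMap

@[simp] theorem tensorLin_mapL {A A' B B' : Quant} (Φ : A.Op →ₗ[ℂ] A'.Op)
    (Ψ : B.Op →ₗ[ℂ] B'.Op) (S : A.Op) (T : B.Op) :
    tensorLin Φ Ψ (tmulOp S T) = tmulOp (Φ S) (Ψ T) := by
  simp [tensorLin]

/-- The block of an operator on `A ⊗ L` at vectors `u v : L`: the operator
`(id ⊗ ⟨u|) X (id ⊗ |v⟩)` on `A`. -/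
noncomputable def block {A L : Quant} (u v : L) : (tensor A L).Op →ₗ[ℂ] A.Op :=
  TensorProduct.lift
    (LinearMap.mk₂ ℂ (fun (S : A.Op) (T : L.Op) => ⟪u, T v⟫_ℂ • S)
      (fun S S' T => by simp) (fun c S T => by rw [smul_comm])
      (fun S T T' => by simp [add_smul])
      (fun c S T => by simp [mul_smul])) ∘ₗ
    (opTensorEquiv A L).symm.toLinearMap

@[simp] theorem block_mapL {A L : Quant} (u v : L) (S : A.Op) (T : L.Op) :
    block u v (tmulOp S T) = ⟪u, T v⟫_ℂ • S := by
  simp [block]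

theorem inner_block {A L : Quant} (u v : L) (x y : A) (X : (tensor A L).Op) :
    ⟪x, block u v X y⟫_ℂ = ⟪x ⊗ₜ[ℂ] u, X (y ⊗ₜ[ℂ] v)⟫_ℂ := by
  let f : (tensor A L).Op →ₗ[ℂ] ℂ :=
    { toFun := fun X => ⟪x, block u v X y⟫_ℂ
      map_add' := fun X Y => by simp
      map_smul' := fun c X => by simp }
  let g : (tensor A L).Op →ₗ[ℂ] ℂ :=
    { toFun := fun X => ⟪x ⊗ₜ[ℂ] u, X (y ⊗ₜ[ℂ] v)⟫_ℂ
      map_add' := fun X Y => by simp [inner_add_right]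
      map_smul' := fun c X => inner_smul_right (𝕜 := ℂ) (x ⊗ₜ[ℂ] u) (X (y ⊗ₜ[ℂ] v)) c }
  have : f = g := op_ext fun S T => by
    have h1 : f (tmulOp S T) = ⟪x, S y⟫_ℂ * ⟪u, T v⟫_ℂ := by
      simp [f, mul_comm]
    exact h1.trans (TensorProduct.inner_tmul _ _ _ _ _).symm
  exact LinearMap.congr_fun this X

theorem block_tensorLin_id {A B L : Quant} (Φ : A.Op →ₗ[ℂ] B.Op) (u v : L)
    (X : (tensor A L).Op) :
    block u v (tensorLin Φ (LinearMap.id : L.Op →ₗ[ℂ] L.Op) X) = Φ (block u v X) := by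
  have : block u v ∘ₗ tensorLin Φ (LinearMap.id : L.Op →ₗ[ℂ] L.Op) = Φ ∘ₗ block u v :=
    op_ext fun S T => by simp
  exact LinearMap.congr_fun this X

theorem exists_sum_tmul {A L : Quant} {ι : Type*} [Fintype ι] (e : OrthonormalBasis ι ℂ L)
    (z : A ⊗[ℂ] L) : ∃ y : ι → A, z = ∑ k, y k ⊗ₜ[ℂ] e k := by
  induction z using TensorProduct.induction_on with
  | zero => exact ⟨0, by simp⟩
  | tmul a l =>
    refine ⟨fun k => ⟪e k, l⟫_ℂ • a, ?_⟩
    conv_lhs => rw [← e.sum_repr' l]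
    simp [TensorProduct.tmul_sum, TensorProduct.smul_tmul]
  | add z w hz hw =>
    obtain ⟨y, rfl⟩ := hz
    obtain ⟨y', rfl⟩ := hw
    exact ⟨y + y', by simp [TensorProduct.add_tmul, Finset.sum_add_distrib]⟩

theorem inner_sum_block {A L : Quant} {ι : Type*} [Fintype ι] (e : ι → L) (x y : ι → A)
    (X : (tensor A L).Op) :
    inner ℂ (∑ a, x a ⊗ₜ[ℂ] e a : tensor A L) (X (∑ b, y b ⊗ₜ[ℂ] e b)) =
      ∑ a, ∑ b, ⟪x a, block (e a) (e b) X (y b)⟫_ℂ := by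
  rw [map_sum, sum_inner]
  refine Finset.sum_congr rfl fun a _ => ?_
  rw [inner_sum]
  exact Finset.sum_congr rfl fun b _ => (inner_block _ _ _ _ _).symm

/-- Complete positivity is stable under tensoring with an identity. -/
theorem tensorLin_id_nonneg {A B : Quant} (f : A ⟶ B) (L : Quant) (k : ℕ)
    (M : CStarMatrix (Fin k) (Fin k) (tensor A L).Op) (hM : 0 ≤ M) :
    0 ≤ M.map (tensorLin (linMap f) (LinearMap.id : L.Op →ₗ[ℂ] L.Op)) := by
  let e := stdOrthonormalBasis ℂ L
  let N : CStarMatrix (Fin k × Fin (Module.finrank ℂ L)) (Fin k × Fin (Module.finrank ℂ L)) A.Op :=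
    CStarMatrix.ofMatrix fun p q => block (e p.2) (e q.2) (M p.1 q.1)
  have hN : 0 ≤ N := by
    rw [CStarMatrix.nonneg_iff_sum_inner] at hM ⊢
    intro x
    refine (hM fun i => ∑ a, x (i, a) ⊗ₜ[ℂ] e a).trans_eq ?_
    rw [Fintype.sum_prod_type]
    refine Finset.sum_congr rfl fun i _ => ?_
    simp_rw [Fintype.sum_prod_type]
    rw [Finset.sum_comm]
    exact Finset.sum_congr rfl fun j _ => inner_sum_block _ _ _ _
  have hfN := Hom.nonneg f N hN
  rw [CStarMatrix.nonneg_iff_sum_inner] at hfN ⊢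
  intro z
  choose y hy using fun i => exists_sum_tmul e (z i)
  refine (hfN fun p => y p.1 p.2).trans_eq ?_
  rw [Fintype.sum_prod_type]
  refine Finset.sum_congr rfl fun i _ => ?_
  simp_rw [Fintype.sum_prod_type]
  rw [Finset.sum_comm]
  refine Finset.sum_congr rfl fun j _ => ?_
  rw [hy i, hy j]
  refine Eq.trans ?_ (inner_sum_block _ _ _ _).symm
  refine Finset.sum_congr rfl fun a _ => Finset.sum_congr rfl fun b _ => ?_
  exact congrArg (fun S : B.Op => ⟪y i a, S (y j b)⟫_ℂ)
    (block_tensorLin_id (linMap f) (e a) (e b) (M i j)).symm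

/-- The morphism `f ⊗ id_L`. -/
noncomputable def whiskerR {A B : Quant} (f : A ⟶ B) (L : Quant) : tensor A L ⟶ tensor B L :=
  Hom.ofLinear (tensorLin (linMap f) LinearMap.id) (tensorLin_id_nonneg f L)

@[simp] theorem linMap_whiskerR {A B : Quant} (f : A ⟶ B) (L : Quant) (S : A.Op) (T : L.Op) :
    linMap (whiskerR f L) (tmulOp S T) = tmulOp (linMap f S) T :=
  tensorLin_mapL _ _ _ _

/-- The symmetry `A ⊗ B ≅ B ⊗ A`. -/
noncomputable def swap (A B : Quant) : tensor A B ≅ tensor B A :=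
  conjIso (TensorProduct.commIsometry ℂ A B)

/-- The associator. -/
noncomputable def assoc (A B C : Quant) : tensor (tensor A B) C ≅ tensor A (tensor B C) :=
  conjIso (TensorProduct.assocIsometry ℂ A B C)

/-- The monoidal unit, the one-dimensional Hilbert space `ℂ`. -/
noncomputable abbrev unit : Quant := ⟨ℂ⟩

/-- The left unitor. -/
noncomputable def lunit (A : Quant) : tensor unit A ≅ A :=
  conjIso (TensorProduct.lidIsometry ℂ A)

/-- The right unitor. -/
noncomputable def runit (A : Quant) : tensor A unit ≅ A :=
  conjIso (TensorProduct.ridIsometry ℂ A)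

@[simp] theorem linMap_swap {A B : Quant} (S : A.Op) (T : B.Op) :
    linMap (swap A B).hom (tmulOp S T) = tmulOp T S := by
  refine ContinuousLinearMap.coe_injective (TensorProduct.ext' fun b a => ?_)
  simp [swap, tmulOp]

@[simp] theorem linMap_assoc {A B C : Quant} (S : A.Op) (T : B.Op) (U : C.Op) :
    linMap (assoc A B C).hom (tmulOp (tmulOp S T) U) =
      tmulOp S (tmulOp T U) := by
  refine ContinuousLinearMap.coe_injective (TensorProduct.ext_threefold' fun a b c => ?_)
  simp [assoc, tmulOp]

@[simp] theorem linMap_assoc_inv {A B C : Quant} (S : A.Op) (T : B.Op) (U : C.Op) :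
    linMap (assoc A B C).inv (tmulOp S (tmulOp T U)) =
      tmulOp (tmulOp S T) U := by
  rw [← linMap_assoc]
  exact LinearMap.congr_fun (congrArg linMap (assoc A B C).hom_inv_id) _

@[simp] theorem linMap_lunit {A : Quant} (c : unit.Op) (S : A.Op) :
    linMap (lunit A).hom (tmulOp c S) = c 1 • S := by
  ext a
  simp [lunit, tmulOp]

@[simp] theorem linMap_runit {A : Quant} (S : A.Op) (c : unit.Op) :
    linMap (runit A).hom (tmulOp S c) = c 1 • S := by
  ext a
  simp [runit, tmulOp]

/-- The morphism `id_L ⊗ f`. -/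
noncomputable def whiskerL (L : Quant) {A B : Quant} (f : A ⟶ B) : tensor L A ⟶ tensor L B :=
  (swap L A).hom ≫ whiskerR f L ≫ (swap B L).hom

@[simp] theorem linMap_whiskerL {A B : Quant} (f : A ⟶ B) (L : Quant) (T : L.Op) (S : A.Op) :
    linMap (whiskerL L f) (tmulOp T S) = tmulOp T (linMap f S) := by
  simp only [whiskerL, linMap_comp, LinearMap.comp_apply, linMap_swap, linMap_whiskerR]

/-- The tensor product of completely positive maps. -/
noncomputable def tensorMor {A A' B B' : Quant} (f : A ⟶ A') (g : B ⟶ B') :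
    tensor A B ⟶ tensor A' B' :=
  whiskerR f B ≫ whiskerL A' g

@[simp] theorem linMap_tensorMor {A A' B B' : Quant} (f : A ⟶ A') (g : B ⟶ B')
    (S : A.Op) (T : B.Op) :
    linMap (tensorMor f g) (tmulOp S T) =
      tmulOp (linMap f S) (linMap g T) := by
  simp only [tensorMor, linMap_comp, LinearMap.comp_apply, linMap_whiskerR, linMap_whiskerL]

section Coherence

variable {A B C D A' B' C' : Quant}

theorem tensorMor_id (A B : Quant) : tensorMor (𝟙 A) (𝟙 B) = 𝟙 (tensor A B) :=
  hom_ext <| op_ext fun S T => by simp only [linMap_tensorMor, linMap_id, LinearMap.id_apply]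

theorem id_tensorMor (f : B ⟶ B') : tensorMor (𝟙 A) f = whiskerL A f :=
  hom_ext <| op_ext fun S T => by
    simp only [linMap_tensorMor, linMap_whiskerL, linMap_id, LinearMap.id_apply]

theorem tensorMor_id_right (f : A ⟶ A') : tensorMor f (𝟙 B) = whiskerR f B :=
  hom_ext <| op_ext fun S T => by
    simp only [linMap_tensorMor, linMap_whiskerR, linMap_id, LinearMap.id_apply]

theorem tensorMor_comp (f : A ⟶ B) (f' : A' ⟶ B') (g : B ⟶ C) (g' : B' ⟶ C') :
    tensorMor f f' ≫ tensorMor g g' = tensorMor (f ≫ g) (f' ≫ g') :=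
  hom_ext <| op_ext fun S T => by
    simp only [linMap_tensorMor, linMap_comp, LinearMap.comp_apply]

theorem assoc_naturality (f : A ⟶ A') (g : B ⟶ B') (h : C ⟶ C') :
    tensorMor (tensorMor f g) h ≫ (assoc A' B' C').hom =
      (assoc A B C).hom ≫ tensorMor f (tensorMor g h) :=
  hom_ext <| op_ext₃ fun S T U => by
    simp only [linMap_tensorMor, linMap_comp, LinearMap.comp_apply, linMap_assoc]

theorem lunit_naturality (f : A ⟶ B) :
    tensorMor (𝟙 unit) f ≫ (lunit B).hom = (lunit A).hom ≫ f :=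
  hom_ext <| op_ext fun c S => by
    simp only [linMap_tensorMor, linMap_comp, LinearMap.comp_apply, linMap_lunit, linMap_id,
      LinearMap.id_apply, map_smul]

theorem runit_naturality (f : A ⟶ B) :
    tensorMor f (𝟙 unit) ≫ (runit B).hom = (runit A).hom ≫ f :=
  hom_ext <| op_ext fun S c => by
    simp only [linMap_tensorMor, linMap_comp, LinearMap.comp_apply, linMap_runit, linMap_id,
      LinearMap.id_apply, map_smul]

theorem tensor_pentagon (A B C D : Quant) :
    tensorMor (assoc A B C).hom (𝟙 D) ≫ (assoc A (tensor B C) D).hom ≫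
        tensorMor (𝟙 A) (assoc B C D).hom =
      (assoc (tensor A B) C D).hom ≫ (assoc A B (tensor C D)).hom :=
  hom_ext <| op_ext₄ fun S T U V => by
    simp only [linMap_tensorMor, linMap_comp, LinearMap.comp_apply, linMap_assoc, linMap_id,
      LinearMap.id_apply]

theorem tensor_triangle (A B : Quant) :
    (assoc A unit B).hom ≫ tensorMor (𝟙 A) (lunit B).hom = tensorMor (runit A).hom (𝟙 B) :=
  hom_ext <| op_ext₃ fun S c T => by
    simp only [linMap_tensorMor, linMap_comp, LinearMap.comp_apply, linMap_assoc, linMap_id,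
      LinearMap.id_apply, linMap_lunit, linMap_runit, smul_tmulOp,
      tmulOp_smul]

theorem swap_naturality_right (A : Quant) (f : B ⟶ C) :
    whiskerL A f ≫ (swap A C).hom = (swap A B).hom ≫ whiskerR f A :=
  hom_ext <| op_ext fun S T => by
    simp only [linMap_swap, linMap_whiskerL, linMap_whiskerR, linMap_comp, LinearMap.comp_apply]

theorem swap_naturality_left (f : A ⟶ B) (C : Quant) :
    whiskerR f C ≫ (swap B C).hom = (swap A C).hom ≫ whiskerL C f :=
  hom_ext <| op_ext fun S T => by
    simp only [linMap_swap, linMap_whiskerL, linMap_whiskerR, linMap_comp, LinearMap.comp_apply]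

theorem swap_symmetry (A B : Quant) : (swap A B).hom ≫ (swap B A).hom = 𝟙 (tensor A B) :=
  hom_ext <| op_ext fun S T => by
    simp only [linMap_swap, linMap_comp, LinearMap.comp_apply, linMap_id, LinearMap.id_apply]

theorem swap_hexagon (A B C : Quant) :
    (assoc A B C).hom ≫ (swap A (tensor B C)).hom ≫ (assoc B C A).hom =
      whiskerR (swap A B).hom C ≫ (assoc B A C).hom ≫ whiskerL B (swap A C).hom :=
  hom_ext <| op_ext₃ fun S T U => by
    simp only [linMap_swap, linMap_whiskerL, linMap_whiskerR, linMap_assoc, linMap_comp,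
      LinearMap.comp_apply]

theorem swap_hexagon' (A B C : Quant) :
    (assoc A B C).inv ≫ (swap (tensor A B) C).hom ≫ (assoc C A B).inv =
      whiskerL A (swap B C).hom ≫ (assoc A C B).inv ≫ whiskerR (swap A C).hom B := by
  rw [← Iso.cancel_iso_hom_left (assoc A B C), Iso.hom_inv_id_assoc]
  refine hom_ext <| op_ext₃ fun S T U => ?_
  simp only [linMap_swap, linMap_whiskerL, linMap_whiskerR, linMap_assoc, linMap_comp,
      LinearMap.comp_apply, linMap_assoc_inv]

end Coherence

noncomputable instance : MonoidalCategoryStruct Quant where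
  tensorObj := tensor
  whiskerLeft L _ _ f := whiskerL L f
  whiskerRight f L := whiskerR f L
  tensorHom f g := tensorMor f g
  tensorUnit := unit
  associator := assoc
  leftUnitor := lunit
  rightUnitor := runit

noncomputable instance : MonoidalCategory Quant :=
  MonoidalCategory.ofTensorHom
    (id_tensorHom_id := tensorMor_id)
    (id_tensorHom := fun _ _ _ f => id_tensorMor f)
    (tensorHom_id := fun f _ => tensorMor_id_right f)
    (tensorHom_comp_tensorHom := tensorMor_comp)
    (associator_naturality := assoc_naturality)
    (leftUnitor_naturality := lunit_naturality)
    (rightUnitor_naturality := runit_naturality)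
    (pentagon := tensor_pentagon)
    (triangle := tensor_triangle)

noncomputable instance : SymmetricCategory Quant where
  braiding := swap
  braiding_naturality_right A _ _ f := swap_naturality_right A f
  braiding_naturality_left f C := swap_naturality_left f C
  hexagon_forward := swap_hexagon
  hexagon_reverse := swap_hexagon'
  symmetry := swap_symmetry

/-- The completely mixed state of `A`: the completely positive map `B(ℂ) → B(A)` whose value at
`1` is the density matrix `id_A`. -/
noncomputable def mixedState (A : Quant) : 𝟙_ Quant ⟶ A :=
  ofStarHom (A := unit)
    { toFun := fun c => c 1 • (1 : A.Op)
      map_smul' := fun r c => by simp [mul_smul]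
      map_zero' := by simp
      map_add' := fun c d => by simp [add_smul]
      map_mul' := fun c d => by
        have h : c (d 1) = c 1 * d 1 := by
          have := c.map_smul (d 1) 1
          rwa [smul_eq_mul, mul_one, smul_eq_mul, mul_comm] at this
        rw [smul_mul_smul_comm, one_mul, mul_apply_eq_comp, h]
      map_star' := fun c => by
        have h : (star c) 1 = star (c 1) := by
          have := ContinuousLinearMap.adjoint_inner_right c (1 : ℂ) (1 : ℂ)
          simpa [ContinuousLinearMap.star_eq_adjoint] using this
        rw [h, star_smul, star_one] }

theorem linMap_mixedState (A : Quant) (c : unit.Op) :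
    linMap (mixedState A) c = c 1 • (1 : A.Op) := rfl

end Quant

section Lifting

universe v u

variable {𝒞 : Type u} [Category.{v} 𝒞] [MonoidalCategory 𝒞]

/-- The relation `f ⊘ g`: every `f ⊗ id_A` has the left lifting property with respect to every
`g ⊗ id_B`. -/
def StableLift {X Y Z W : 𝒞} (f : X ⟶ Y) (g : Z ⟶ W) : Prop :=
  ∀ A B : 𝒞, HasLiftingProperty (f ▷ A) (g ▷ B)

/-- The class `𝒜^⊘` of morphisms `g` with `f ⊘ g` for all `f ∈ 𝒜`. -/
def stableRightLift (𝒜 : MorphismProperty 𝒞) : MorphismProperty 𝒞 :=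
  fun _ _ g => ∀ ⦃X Y : 𝒞⦄ (f : X ⟶ Y), 𝒜 f → StableLift f g

/-- The class `^⊘𝒜` of morphisms `f` with `f ⊘ g` for all `g ∈ 𝒜`. -/
def stableLeftLift (𝒜 : MorphismProperty 𝒞) : MorphismProperty 𝒞 :=
  fun _ _ f => ∀ ⦃Z W : 𝒞⦄ (g : Z ⟶ W), 𝒜 g → StableLift f g

/-- Given a family `μ` of completely mixed states, the pure morphisms `𝒫 = ℳ₀^⊘`, where `ℳ₀` is
the collection of all completely mixed states. -/
def pureMorphisms (μ : ∀ A : 𝒞, 𝟙_ 𝒞 ⟶ A) : MorphismProperty 𝒞 :=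
  stableRightLift (MorphismProperty.ofHoms μ)

/-- The mixing morphisms `ℳ = ^⊘𝒫`. -/
def mixingMorphisms (μ : ∀ A : 𝒞, 𝟙_ 𝒞 ⟶ A) : MorphismProperty 𝒞 :=
  stableLeftLift (pureMorphisms μ)

/-- The simple mixing maps: the morphisms `A ⟶ B` of the form `p ∘ (id_A ⊗ μ_C)` with
`p : A ⊗ C ⟶ B` an isomorphism (up to the unitor `A ≅ A ⊗ I`). -/
def simpleMixingMaps (μ : ∀ A : 𝒞, 𝟙_ 𝒞 ⟶ A) : MorphismProperty 𝒞 :=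
  fun A B m => ∃ (C : 𝒞) (p : A ⊗ C ⟶ B), IsIso p ∧ m = (ρ_ A).inv ≫ (A ◁ μ C) ≫ p

end Lifting

/-!
Every completely positive map has the form `S ↦ V (S ⊗ 1) V†`: it adjoins a completely mixed
environment and then conjugates by an operator `V`, a dilation of the map. Two dilations of the same
map differ by a partial isometry `U` of the environments. Consequently every conjugation
`W (-) W†` is pure: if dilations `K` and `H` of the two sides of a square satisfy
`(W K) (1 ⊗ U) = H`, the lift is assembled from `K (1 ⊗ U)` and the remainder
`K (1 ⊗ (1 - U U†))`, which `W` kills.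

A mixing map with a minimal dilation `K` therefore lifts against `K (-) K†`. A dilation of the lift
yields, on a suitable vector of its environment, an inverse of the operator `K`. Hence `K (-) K†` is
an isomorphism, and the map is a simple mixing map. Conversely, adjoining a mixed system is mixing
in any symmetric monoidal category, since `id_A ⊗ μ_C` is `μ_C ⊗ id_A` up to the symmetry.
-/

section Lifting

universe v u

variable {𝒞 : Type u} [Category.{v} 𝒞] [MonoidalCategory 𝒞]

theorem StableLift.hasLiftingProperty {X Y Z W : 𝒞} {f : X ⟶ Y} {g : Z ⟶ W}
    (h : StableLift f g) : HasLiftingProperty f g := by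
  have := h (𝟙_ 𝒞) (𝟙_ 𝒞)
  have hf : f = (ρ_ X).inv ≫ f ▷ 𝟙_ 𝒞 ≫ (ρ_ Y).hom := by simp
  have hg : g = (ρ_ Z).inv ≫ g ▷ 𝟙_ 𝒞 ≫ (ρ_ W).hom := by simp
  rw [hf, hg]
  infer_instance

/-- The morphism `A ≅ A ⊗ I ⟶ A ⊗ C` that adjoins to `A` a system `C` in the state `m`. -/
def adjoin {C : 𝒞} (m : 𝟙_ 𝒞 ⟶ C) (A : 𝒞) : A ⟶ A ⊗ C := (ρ_ A).inv ≫ A ◁ m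

variable [SymmetricCategory 𝒞]

theorem adjoin_comp_braiding {C : 𝒞} (m : 𝟙_ 𝒞 ⟶ C) (A : 𝒞) :
    adjoin m A ≫ (β_ A C).hom = (λ_ A).inv ≫ m ▷ A := by
  rw [adjoin, Category.assoc, BraidedCategory.braiding_naturality_right,
    rightUnitor_inv_braiding_assoc]

theorem adjoin_whiskerRight {C : 𝒞} (m : 𝟙_ 𝒞 ⟶ C) (A B : 𝒞) :
    adjoin m A ▷ B =
      adjoin m (A ⊗ B) ≫ (β_ (A ⊗ B) C).hom ≫ (α_ C A B).inv ≫ (β_ A C).inv ▷ B := by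
  have h : adjoin m A = (λ_ A).inv ≫ m ▷ A ≫ (β_ A C).inv := by
    rw [← Category.assoc, ← adjoin_comp_braiding, Category.assoc, Iso.hom_inv_id, Category.comp_id]
  rw [← Category.assoc (adjoin m (A ⊗ B)), adjoin_comp_braiding, h]
  simp only [comp_whiskerRight, leftUnitor_tensor_inv, whiskerRight_tensor, Category.assoc,
    Iso.hom_inv_id_assoc]

theorem hasLiftingProperty_whiskerRight_iff {C X Y : 𝒞} {m : 𝟙_ 𝒞 ⟶ C} {A : 𝒞} {g : X ⟶ Y} :
    HasLiftingProperty (m ▷ A) g ↔ HasLiftingProperty (adjoin m A) g :=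
  HasLiftingProperty.iff_of_arrow_iso_left
    (Arrow.isoMk (λ_ A) (β_ A C).symm <| by
      simp [← cancel_mono (β_ A C).hom, adjoin_comp_braiding]) g

theorem simpleMixingMaps_le_mixingMorphisms (μ : ∀ A : 𝒞, 𝟙_ 𝒞 ⟶ A) :
    simpleMixingMaps μ ≤ mixingMorphisms μ := by
  rintro A B _ ⟨C, p, hp, rfl⟩ Z W g hg A' B'
  have := hasLiftingProperty_whiskerRight_iff.mp (hg (μ C) ⟨C⟩ (A ⊗ A') B')
  have h : ((ρ_ A).inv ≫ A ◁ μ C ≫ p) ▷ A' = adjoin (μ C) A ▷ A' ≫ p ▷ A' := by simp [adjoin]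
  rw [h, adjoin_whiskerRight]
  infer_instance

end Lifting

section Gram

open ContinuousLinearMap InnerProductSpace Submodule

variable {𝕜 E F ι : Type*} [RCLike 𝕜] [NormedAddCommGroup E] [InnerProductSpace 𝕜 E]
  [NormedAddCommGroup F] [InnerProductSpace 𝕜 F] {t : ι → E} {s : ι → F}

theorem exists_linearIsometry_span_of_gram_eq
    (h : ∀ i j, inner 𝕜 (t i) (t j) = inner 𝕜 (s i) (s j)) :
    ∃ T : span 𝕜 (Set.range t) →ₗᵢ[𝕜] F, ∀ i (hi : t i ∈ span 𝕜 (Set.range t)),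
      T ⟨t i, hi⟩ = s i := by
  rw [← Finsupp.range_linearCombination]
  let L₁ : (ι →₀ 𝕜) →ₗ[𝕜] E := Finsupp.linearCombination 𝕜 t
  let L₂ : (ι →₀ 𝕜) →ₗ[𝕜] F := Finsupp.linearCombination 𝕜 s
  have gram_eq (a b) : inner 𝕜 (L₁ a) (L₁ b) = inner 𝕜 (L₂ a) (L₂ b) := by
    simp only [L₁, L₂, Finsupp.linearCombination_apply, Finsupp.sum, sum_inner, inner_sum,
      inner_smul_left, inner_smul_right, h]
  obtain ⟨R, hR⟩ := L₁.rangeRestrict.exists_rightInverse_of_surjective L₁.range_rangeRestrict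
  have L₁_R (z) : L₁ (R z) = z := congrArg Subtype.val (LinearMap.congr_fun hR z)
  have L₂_eq (a b) (hab : L₁ a = L₁ b) : L₂ a = L₂ b := by
    rw [← sub_eq_zero, ← map_sub, ← inner_self_eq_zero (𝕜 := 𝕜), ← gram_eq, map_sub, hab, sub_self,
      inner_zero_left]
  refine ⟨(L₂ ∘ₗ R).isometryOfInner fun z w => ?_, fun i hi => ?_⟩
  · rw [LinearMap.comp_apply, LinearMap.comp_apply, ← gram_eq, L₁_R, L₁_R, coe_inner]
  · refine (L₂_eq _ (Finsupp.single i 1) ?_).trans ?_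
    · simp [L₁_R, L₁]
    · simp [L₂]

theorem exists_partialIsometry_of_gram_eq [CompleteSpace E] [CompleteSpace F]
    [(span 𝕜 (Set.range t)).HasOrthogonalProjection]
    (h : ∀ i j, inner 𝕜 (t i) (t j) = inner 𝕜 (s i) (s j)) :
    ∃ S : E →L[𝕜] F, (∀ i, S (t i) = s i) ∧ (∀ i, adjoint S (s i) = t i) ∧
      IsStarProjection (adjoint S ∘L S) := by
  obtain ⟨T, hT⟩ := exists_linearIsometry_span_of_gram_eq h
  let P := (span 𝕜 (Set.range t)).orthogonalProjectionOnto
  let S := T.toContinuousLinearMap ∘L P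
  have ht (i) : t i ∈ span 𝕜 (Set.range t) := subset_span (Set.mem_range_self i)
  have hS (i) : S (t i) = s i := by
    rw [← hT i (ht i)]
    exact congrArg T (orthogonalProjectionOnto_mem_subspace_eq_self ⟨t i, ht i⟩)
  have hSS : adjoint S ∘L S = (span 𝕜 (Set.range t)).starProjection := by
    ext x
    refine ext_inner_left 𝕜 fun y => ?_
    rw [ContinuousLinearMap.comp_apply, adjoint_inner_right]
    exact (T.inner_map_map (P y) (P x)).trans
      (inner_orthogonalProjectionOnto_eq_of_mem_right (P x) y)
  refine ⟨S, hS, fun i => ?_, hSS ▸ isStarProjection_starProjection⟩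
  rw [← hS i]
  exact (DFunLike.congr_fun hSS (t i)).trans (starProjection_eq_self_iff.mpr (ht i))

end Gram

namespace Quant

open ContinuousLinearMap InnerProductSpace TensorProduct

variable {A B C E F G X Y : Quant}

instance (A B : Quant) : CompleteSpace (A ⊗[ℂ] B) := FiniteDimensional.complete ℂ _

theorem tensorHom_ext {V : Type*} [AddCommMonoid V] [Module ℂ V] [TopologicalSpace V]
    {K L : tensor A B →L[ℂ] V} (h : ∀ x v, K (x ⊗ₜ[ℂ] v) = L (x ⊗ₜ[ℂ] v)) : K = L :=
  ContinuousLinearMap.coe_injective (TensorProduct.ext' h)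

/-- The completely positive map `S ↦ V S V†` given by an operator `V : A → B`, i.e. the morphism
with a single Kraus operator `V`. -/
noncomputable def conj (V : A →L[ℂ] B) : A ⟶ B :=
  Hom.ofLinear
    { toFun := fun S => V ∘L S ∘L adjoint V
      map_add' := fun S T => by simp
      map_smul' := fun c S => by simp }
    fun k M hM => by
      rw [CStarMatrix.nonneg_iff_sum_inner] at hM ⊢
      intro x
      refine (hM fun i => adjoint V (x i)).trans_eq ?_
      simp [adjoint_inner_left]

theorem linMap_conj (V : A →L[ℂ] B) (S : A.Op) : linMap (conj V) S = V ∘L S ∘L adjoint V := rfl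

theorem conj_comp_conj (V : A →L[ℂ] B) (W : B →L[ℂ] C) : conj V ≫ conj W = conj (W ∘L V) := by
  refine hom_ext (LinearMap.ext fun S => ?_)
  rw [linMap_comp, LinearMap.comp_apply, linMap_conj, linMap_conj, linMap_conj, adjoint_comp]
  rfl

theorem conj_id (A : Quant) : conj (.id ℂ A) = 𝟙 A := by
  refine hom_ext (LinearMap.ext fun S => ?_)
  rw [linMap_conj, adjoint_id]
  rfl

theorem isIso_conj {K : A →L[ℂ] B} {R : B →L[ℂ] A} (hKR : K ∘L R = .id ℂ B)
    (hRK : R ∘L K = .id ℂ A) : IsIso (conj K) :=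
  ⟨conj R, by rw [conj_comp_conj, hRK, conj_id], by rw [conj_comp_conj, hKR, conj_id]⟩

theorem linMap_conj_zero : linMap (conj (0 : A →L[ℂ] B)) = 0 := by
  refine LinearMap.ext fun S => ?_
  rw [linMap_conj, zero_comp, LinearMap.zero_apply]

theorem linMap_conj_rTensor (V : A →L[ℂ] B) (S : A.Op) (T : C.Op) :
    linMap (conj (V.rTensor C : tensor A C →L[ℂ] tensor B C)) (tmulOp S T) =
      tmulOp (linMap (conj V) S) T := by
  change V.rTensor C ∘L mapL S T ∘L adjoint (V.rTensor C) = mapL (V ∘L S ∘L adjoint V) T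
  rw [adjoint_rTensor, mapL_comp_rTensor, rTensor_comp_mapL]

theorem linMap_conj_lTensor (U : E →L[ℂ] F) (S : A.Op) (T : E.Op) :
    linMap (conj (U.lTensor A : tensor A E →L[ℂ] tensor A F)) (tmulOp S T) =
      tmulOp S (linMap (conj U) T) := by
  change U.lTensor A ∘L mapL S T ∘L adjoint (U.lTensor A) = mapL S (U ∘L T ∘L adjoint U)
  rw [adjoint_lTensor, mapL_comp_lTensor, lTensor_comp_mapL]

theorem conj_whiskerRight (V : A →L[ℂ] B) (C : Quant) :
    conj V ▷ C = conj (V.rTensor C : tensor A C →L[ℂ] tensor B C) :=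
  hom_ext <| op_ext fun S T =>
    (linMap_whiskerR (conj V) C S T).trans (linMap_conj_rTensor V S T).symm

/-- The morphism `S ↦ S ⊗ 1` that adjoins to `A` a completely mixed system `C`. -/
noncomputable def mix (A C : Quant) : A ⟶ tensor A C := adjoin (mixedState C) A

theorem linMap_runit_inv (S : A.Op) : linMap (runit A).inv S = tmulOp S 1 := by
  have h : linMap (runit A).hom (tmulOp S 1) = S := (linMap_runit S 1).trans (one_smul ℂ S)
  conv_lhs => rw [← h]
  exact LinearMap.congr_fun (congrArg linMap (runit A).hom_inv_id) _

theorem linMap_mix (S : A.Op) : linMap (mix A C) S = tmulOp S 1 := by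
  change linMap (whiskerL A (mixedState C)) (linMap (runit A).inv S) = _
  rw [linMap_runit_inv, linMap_whiskerL, linMap_mixedState]
  exact congrArg (tmulOp S) (one_smul ℂ (1 : C.Op))

/-- The morphism `S ↦ V (S ⊗ 1) V†`. We call `V` a dilation of it, with environment `E`. -/
noncomputable def ofDilation (V : tensor A E →L[ℂ] B) : A ⟶ B := mix A E ≫ conj V

theorem linMap_ofDilation (V : tensor A E →L[ℂ] B) (S : A.Op) :
    linMap (ofDilation V) S = V ∘L tmulOp S 1 ∘L adjoint V := by
  rw [ofDilation, linMap_comp, LinearMap.comp_apply, linMap_mix, linMap_conj]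

theorem ofDilation_comp_conj (V : tensor A E →L[ℂ] B) (W : B →L[ℂ] C) :
    ofDilation V ≫ conj W = ofDilation (W ∘L V) := by
  rw [ofDilation, Category.assoc, conj_comp_conj, ofDilation]

theorem linMap_ofDilation_zero : linMap (ofDilation (0 : tensor A E →L[ℂ] B)) = 0 := by
  rw [ofDilation, linMap_comp, linMap_conj_zero, LinearMap.zero_comp]

theorem ofDilation_id (A E : Quant) : ofDilation (.id ℂ (tensor A E)) = mix A E := by
  rw [ofDilation, conj_id, Category.comp_id]

theorem conj_comp_ofDilation (V : A →L[ℂ] B) (H : tensor B G →L[ℂ] C) :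
    conj V ≫ ofDilation H =
      ofDilation (H ∘L (V.rTensor G : tensor A G →L[ℂ] tensor B G)) := by
  rw [ofDilation, ← ofDilation_comp_conj, ofDilation, ← Category.assoc]
  congr 1
  refine hom_ext (LinearMap.ext fun S => ?_)
  simp only [linMap_comp, LinearMap.comp_apply, linMap_mix, linMap_conj_rTensor]

theorem conj_isometryEquiv (u : A ≃ₗᵢ[ℂ] B) : conj (u : A →L[ℂ] B) = (conjIso u).hom := by
  refine hom_ext (LinearMap.ext fun S => ?_)
  rw [linMap_conj, LinearIsometryEquiv.adjoint_eq_symm]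
  rfl

theorem tmulOp_one_one (A B : Quant) : tmulOp (1 : A.Op) (1 : B.Op) = 1 := mapL_id_id

/-- The associator `(A ⊗ E) ⊗ G → A ⊗ (E ⊗ G)` as an operator. -/
noncomputable def assocL (A E G : Quant) : tensor (tensor A E) G →L[ℂ] tensor A (tensor E G) :=
  TensorProduct.assocIsometry ℂ A E G

/-- The inverse associator `A ⊗ (E ⊗ G) → (A ⊗ E) ⊗ G` as an operator. -/
noncomputable def assocInvL (A E G : Quant) :
    tensor A (tensor E G) →L[ℂ] tensor (tensor A E) G :=
  (TensorProduct.assocIsometry ℂ A E G).symm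

theorem assocL_comp_assocInvL (A E G : Quant) :
    assocL A E G ∘L assocInvL A E G = .id ℂ (tensor A (tensor E G)) :=
  ContinuousLinearMap.ext (TensorProduct.assocIsometry ℂ A E G).apply_symm_apply

theorem assocInvL_comp_assocL (A E G : Quant) :
    assocInvL A E G ∘L assocL A E G = .id ℂ (tensor (tensor A E) G) :=
  ContinuousLinearMap.ext (TensorProduct.assocIsometry ℂ A E G).symm_apply_apply

theorem mix_comp_ofDilation (H : tensor (tensor A E) G →L[ℂ] B) :
    mix A E ≫ ofDilation H = ofDilation (H ∘L assocInvL A E G) := by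
  have h : conj (assocInvL A E G) = (assoc A E G).inv := conj_isometryEquiv _
  rw [ofDilation, ← ofDilation_comp_conj, ofDilation, h, ← Category.assoc]
  congr 1
  refine hom_ext (LinearMap.ext fun S => ?_)
  simp only [linMap_comp, LinearMap.comp_apply, linMap_mix, ← tmulOp_one_one E G, linMap_assoc_inv]

/-- The right unitor `A ⊗ ℂ → A` as an operator. -/
noncomputable def ridL (A : Quant) : tensor A unit →L[ℂ] A := TensorProduct.ridIsometry ℂ A

theorem ofDilation_ridL (A : Quant) : ofDilation (ridL A) = 𝟙 A := by
  have h : conj (ridL A) = (runit A).hom := conj_isometryEquiv _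
  rw [ofDilation, h]
  refine hom_ext (LinearMap.ext fun S => ?_)
  rw [linMap_comp, LinearMap.comp_apply, linMap_mix, linMap_runit]
  exact one_smul ℂ S

theorem linMap_ofDilation_comp_lTensor (K : tensor A E →L[ℂ] B) (U : F →L[ℂ] E) (S : A.Op) :
    linMap (ofDilation (K ∘L (U.lTensor A : tensor A F →L[ℂ] tensor A E))) S =
      linMap (conj K) (tmulOp S (U ∘L adjoint U)) := by
  rw [← ofDilation_comp_conj, ofDilation, linMap_comp, linMap_comp, LinearMap.comp_apply,
    LinearMap.comp_apply, linMap_mix, linMap_conj_lTensor, linMap_conj]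
  rfl

theorem ofDilation_comp_lTensor {K : tensor A E →L[ℂ] B} {U : F →L[ℂ] E}
    (h : K ∘L ((U ∘L adjoint U).lTensor A : tensor A E →L[ℂ] tensor A E) = K) :
    ofDilation (K ∘L (U.lTensor A : tensor A F →L[ℂ] tensor A E)) = ofDilation K := by
  refine hom_ext (LinearMap.ext fun S => ?_)
  have hS : (U ∘L adjoint U).lTensor A ∘L tmulOp S 1 = tmulOp S (U ∘L adjoint U) :=
    lTensor_comp_mapL _ _ _
  rw [linMap_ofDilation_comp_lTensor, linMap_ofDilation, linMap_conj, ← hS]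
  exact congrArg (· ∘L tmulOp S 1 ∘L adjoint K) h

instance : Add (A ⟶ B) where
  add f g := Hom.ofLinear (linMap f + linMap g) fun _ M hM =>
    add_nonneg (Hom.nonneg f M hM) (Hom.nonneg g M hM)

theorem linMap_add (f g : A ⟶ B) : linMap (f + g) = linMap f + linMap g := rfl

theorem add_comp (f g : A ⟶ B) (h : B ⟶ C) : (f + g) ≫ h = f ≫ h + g ≫ h :=
  hom_ext <| by simp only [linMap_comp, linMap_add, LinearMap.comp_add]

theorem comp_add (f : A ⟶ B) (g h : B ⟶ C) : f ≫ (g + h) = f ≫ g + f ≫ h := rfl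

theorem ofDilation_comp_lTensor_add {K : tensor A E →L[ℂ] B} {U : F →L[ℂ] E} {V : G →L[ℂ] E}
    (h : U ∘L adjoint U + V ∘L adjoint V = 1) :
    ofDilation (K ∘L (U.lTensor A : tensor A F →L[ℂ] tensor A E)) +
      ofDilation (K ∘L (V.lTensor A : tensor A G →L[ℂ] tensor A E)) = ofDilation K := by
  refine hom_ext (LinearMap.ext fun S => ?_)
  rw [linMap_add, LinearMap.add_apply, linMap_ofDilation_comp_lTensor,
    linMap_ofDilation_comp_lTensor, ← map_add, linMap_ofDilation, ← h]
  exact congrArg (linMap (conj K)) (mapL_add_right S _ _).symm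

theorem exists_mix_comp_eq_id (A C : Quant) : ∃ r : tensor A C ⟶ A, mix A C ≫ r = 𝟙 A := by
  obtain ⟨c, hc⟩ := exists_norm_eq C zero_le_one
  let φ : C →L[ℂ] unit := innerSL ℂ c
  have hφ : φ ∘L adjoint φ = 1 := by
    ext
    simp [φ, adjoint_innerSL_apply, hc]
  refine ⟨conj (ridL A ∘L (φ.lTensor A : tensor A C →L[ℂ] tensor A unit)), ?_⟩
  rw [← ofDilation_ridL]
  refine ofDilation_comp_lTensor ?_
  rw [hφ, lTensor_one]
  rfl

theorem mkL_comp_adjoint_mkL (x x' : A) :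
    (mkL ℂ A E x ∘L adjoint (mkL ℂ A E x') : (tensor A E).Op) = tmulOp (rankOne ℂ x x') 1 := by
  refine tensorHom_ext fun a v => ?_
  have h : adjoint (mkL ℂ A E x') (a ⊗ₜ[ℂ] v) = ⟪x', a⟫_ℂ • v :=
    ext_inner_left ℂ fun w => by
      rw [adjoint_inner_right, inner_smul_right, mkL_apply_apply, inner_tmul]
  calc mkL ℂ A E x (adjoint (mkL ℂ A E x') (a ⊗ₜ[ℂ] v)) = x ⊗ₜ[ℂ] (⟪x', a⟫_ℂ • v) := by
        rw [h, mkL_apply_apply]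
    _ = (rankOne ℂ x x') a ⊗ₜ[ℂ] v := by rw [rankOne_apply, TensorProduct.smul_tmul]

theorem linMap_ofDilation_rankOne (V : tensor A E →L[ℂ] B) (x x' : A) :
    linMap (ofDilation V) (rankOne ℂ x x') =
      (V ∘L mkL ℂ A E x) ∘L adjoint (V ∘L mkL ℂ A E x') := by
  rw [linMap_ofDilation, ← mkL_comp_adjoint_mkL, adjoint_comp]
  rfl

theorem comp_lTensor_eq_of_adjoint {V : tensor A E →L[ℂ] B} {W : tensor A F →L[ℂ] B}
    {U : F →L[ℂ] E}
    (h : ∀ x y, adjoint U (adjoint (V ∘L mkL ℂ A E x) y) = adjoint (W ∘L mkL ℂ A F x) y) :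
    V ∘L (U.lTensor A : tensor A F →L[ℂ] tensor A E) = W :=
  tensorHom_ext fun x v => ext_inner_left ℂ fun y => by
    calc ⟪y, (V ∘L mkL ℂ A E x) (U v)⟫_ℂ = ⟪adjoint (W ∘L mkL ℂ A F x) y, v⟫_ℂ := by
          rw [← h, adjoint_inner_left, adjoint_inner_left]
      _ = ⟪y, W (x ⊗ₜ[ℂ] v)⟫_ℂ := adjoint_inner_left _ _ _

theorem exists_comp_lTensor_eq_of_ofDilation_eq {V : tensor A E →L[ℂ] B} {W : tensor A F →L[ℂ] B}
    (h : ofDilation V = ofDilation W) :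
    ∃ U : F →L[ℂ] E, IsStarProjection (U ∘L adjoint U) ∧
      V ∘L (U.lTensor A : tensor A F →L[ℂ] tensor A E) = W ∧
      W ∘L ((adjoint U).lTensor A : tensor A E →L[ℂ] tensor A F) = V := by
  let t (p : A × B) : E := adjoint (V ∘L mkL ℂ A E p.1) p.2
  let s (p : A × B) : F := adjoint (W ∘L mkL ℂ A F p.1) p.2
  have gram {G : Quant} (Z : tensor A G →L[ℂ] B) (p q : A × B) :
      ⟪adjoint (Z ∘L mkL ℂ A G p.1) p.2, adjoint (Z ∘L mkL ℂ A G q.1) q.2⟫_ℂ =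
        ⟪p.2, linMap (ofDilation Z) (rankOne ℂ p.1 q.1) q.2⟫_ℂ := by
    rw [linMap_ofDilation_rankOne, adjoint_inner_left]
    rfl
  obtain ⟨S, hS, hS', hSS⟩ :=
    exists_partialIsometry_of_gram_eq (𝕜 := ℂ) (t := t) (s := s) fun p q => by rw [gram, gram, h]
  refine ⟨adjoint S, ?_, comp_lTensor_eq_of_adjoint fun x y => ?_,
    comp_lTensor_eq_of_adjoint fun x y => ?_⟩
  · rwa [adjoint_adjoint]
  · rw [adjoint_adjoint]
    exact hS (x, y)
  · rw [adjoint_adjoint]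
    exact hS' (x, y)

theorem op_ext_rankOne {ι : Type*} [Fintype ι] (e : OrthonormalBasis ι ℂ A) {V : Type*}
    [AddCommGroup V] [Module ℂ V] {f g : A.Op →ₗ[ℂ] V}
    (h : ∀ i j, f (rankOne ℂ (e i) (e j)) = g (rankOne ℂ (e i) (e j))) : f = g := by
  refine LinearMap.ext fun S => ?_
  have hS : S = ∑ i, ∑ j, ⟪e i, S (e j)⟫_ℂ • rankOne ℂ (e i) (e j) := by
    ext x
    calc S x = ∑ i, (∑ j, ⟪adjoint S (e i), e j⟫_ℂ * ⟪e j, x⟫_ℂ) • e i := by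
          simp only [e.sum_inner_mul_inner, adjoint_inner_left S x, e.sum_repr']
      _ = (∑ i, ∑ j, ⟪e i, S (e j)⟫_ℂ • rankOne ℂ (e i) (e j)) x := by
          simp only [sum_apply, smul_apply, rankOne_apply, smul_smul, adjoint_inner_left,
            Finset.sum_smul]
  rw [hS]
  simp only [map_sum, map_smul, h]

theorem ofMatrix_rankOne_nonneg {ι : Type*} [Fintype ι] (v : ι → A) :
    0 ≤ (CStarMatrix.ofMatrix fun i j => rankOne ℂ (v i) (v j) : CStarMatrix ι ι A.Op) := by
  rw [CStarMatrix.nonneg_iff_sum_inner]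
  intro x
  calc 0 ≤ star (∑ i, ⟪v i, x i⟫_ℂ) * ∑ j, ⟪v j, x j⟫_ℂ := star_mul_self_nonneg _
    _ = ∑ i, ∑ j, ⟪x i, rankOne ℂ (v i) (v j) (x j)⟫_ℂ := by
        simp only [star_sum, Finset.sum_mul_sum, RCLike.star_def, inner_conj_symm]
        simp only [rankOne_apply, inner_smul_right, mul_comm]

theorem exists_gram_of_nonneg {ι : Type*} [Fintype ι] {M : CStarMatrix ι ι B.Op} (hM : 0 ≤ M) :
    ∃ b : ι → (B →L[ℂ] PiLp 2 fun _ : ι => B), ∀ i j, M i j = adjoint (b i) ∘L b j := by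
  obtain ⟨N, rfl⟩ := (CStarMatrix.nonneg_iff_star_mul_self_aux M).mp hM
  let b (i : ι) : B →L[ℂ] PiLp 2 fun _ : ι => B :=
    (PiLp.continuousLinearEquiv 2 ℂ fun _ : ι => B).symm.toContinuousLinearMap ∘L .pi fun k => N k i
  refine ⟨b, fun i j => ContinuousLinearMap.ext fun y => ext_inner_left ℂ fun z => ?_⟩
  calc ⟪z, (star N * N) i j y⟫_ℂ = ∑ k, ⟪N k i z, N k j y⟫_ℂ := by
        simp only [CStarMatrix.mul_apply, CStarMatrix.star_apply, star_eq_adjoint, sum_apply,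
          mul_apply_eq_comp, inner_sum, adjoint_inner_right]
    _ = ⟪z, adjoint (b i) (b j y)⟫_ℂ := by
        rw [adjoint_inner_right, PiLp.inner_apply]
        rfl

theorem exists_ofDilation_eq (f : A ⟶ B) :
    ∃ (E : Quant) (V : tensor A E →L[ℂ] B), ofDilation V = f := by
  let e := stdOrthonormalBasis ℂ A
  have : Nonempty (Fin (Module.finrank ℂ A)) := ⟨⟨0, Module.finrank_pos⟩⟩
  obtain ⟨b, hb⟩ := exists_gram_of_nonneg (Hom.nonneg f _ (ofMatrix_rankOne_nonneg e))
  let E : Quant := ⟨PiLp 2 fun _ : Fin (Module.finrank ℂ A) => B⟩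
  let V : tensor A E →L[ℂ] B := LinearMap.toContinuousLinearMap <|
    TensorProduct.lift <| e.toBasis.constr ℂ fun i => (adjoint (b i)).toLinearMap
  have hV (i) : V ∘L mkL ℂ A E (e i) = adjoint (b i) := ContinuousLinearMap.coe_injective <| by
    have h := e.toBasis.constr_basis ℂ (fun i => (adjoint (b i)).toLinearMap) i
    rwa [e.coe_toBasis] at h
  refine ⟨E, V, hom_ext <| op_ext_rankOne e fun i j => ?_⟩
  rw [linMap_ofDilation_rankOne, hV, hV, adjoint_adjoint]
  exact (hb i j).symm

/-- The vectors `v` of the environment with `V (x ⊗ v) = 0` for all `x`. The dilation `V` is minimal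
when there are no such `v ≠ 0`. -/
noncomputable def dilationKer (V : tensor A E →L[ℂ] B) : Submodule ℂ E :=
  ⨅ x : A, (V ∘L mkL ℂ A E x).ker

theorem mem_dilationKer {V : tensor A E →L[ℂ] B} {v : E} :
    v ∈ dilationKer V ↔ ∀ x, V (x ⊗ₜ[ℂ] v) = 0 := by
  simp only [dilationKer, Submodule.mem_iInf]
  rfl

theorem eq_zero_of_dilationKer_eq_top {V : tensor A E →L[ℂ] B} (h : dilationKer V = ⊤) : V = 0 :=
  tensorHom_ext fun x _ => mem_dilationKer.mp (h ▸ Submodule.mem_top) x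

theorem comp_lTensor_starProjection_dilationKer (V : tensor A E →L[ℂ] B) :
    V ∘L ((dilationKer V)ᗮ.starProjection.lTensor A : tensor A E →L[ℂ] tensor A E) = V :=
  tensorHom_ext fun x v => by
    have hv : V (x ⊗ₜ[ℂ] (dilationKer V).starProjection v) = 0 :=
      mem_dilationKer.mp ((dilationKer V).starProjection_apply_mem v) x
    calc V (x ⊗ₜ[ℂ] (dilationKer V)ᗮ.starProjection v)
        = V (x ⊗ₜ[ℂ] v - x ⊗ₜ[ℂ] (dilationKer V).starProjection v) := by
          rw [Submodule.starProjection_orthogonal_val, tmul_sub]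
      _ = V (x ⊗ₜ[ℂ] v) := by rw [map_sub, hv, sub_zero]

theorem exists_minimal_ofDilation_eq {f : A ⟶ B} (hf : linMap f ≠ 0) :
    ∃ (E : Quant) (K : tensor A E →L[ℂ] B), ofDilation K = f ∧ dilationKer K = ⊥ := by
  obtain ⟨E, V, rfl⟩ := exists_ofDilation_eq f
  have : Nontrivial (dilationKer V)ᗮ := by
    rw [Submodule.nontrivial_iff_ne_bot, Ne, Submodule.orthogonal_eq_bot_iff]
    intro h
    rw [eq_zero_of_dilationKer_eq_top h] at hf
    exact hf linMap_ofDilation_zero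
  let F : Quant := ⟨(dilationKer V)ᗮ⟩
  let incl : F →L[ℂ] E := (dilationKer V)ᗮ.subtypeL
  have h_incl : incl ∘L adjoint incl = (dilationKer V)ᗮ.starProjection := by
    rw [Submodule.adjoint_subtypeL]
    rfl
  refine ⟨F, V ∘L (incl.lTensor A : tensor A F →L[ℂ] tensor A E), ofDilation_comp_lTensor ?_, ?_⟩
  · rw [h_incl, comp_lTensor_starProjection_dilationKer]
  · refine (Submodule.eq_bot_iff _).mpr fun v hv => Subtype.ext ?_
    have hv' : incl v ∈ dilationKer V := mem_dilationKer.mpr fun x => mem_dilationKer.mp hv x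
    exact Submodule.disjoint_def.mp (dilationKer V).orthogonal_disjoint _ hv' v.2

theorem exists_complementary_comp_lTensor {V : tensor A E →L[ℂ] B} {W : tensor A F →L[ℂ] B}
    (h : ofDilation V = ofDilation W) :
    ∃ (U : F →L[ℂ] E) (N : E.Op), U ∘L adjoint U + N ∘L adjoint N = 1 ∧
      V ∘L (U.lTensor A : tensor A F →L[ℂ] tensor A E) = W ∧
      V ∘L (N.lTensor A : tensor A E →L[ℂ] tensor A E) = 0 := by
  obtain ⟨U, hU, hVU, hWU⟩ := exists_comp_lTensor_eq_of_ofDilation_eq h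
  refine ⟨U, 1 - U ∘L adjoint U, ?_, hVU, ?_⟩
  · have hN := hU.one_sub
    have hNN : (1 - U ∘L adjoint U) ∘L adjoint (1 - U ∘L adjoint U) = 1 - U ∘L adjoint U := by
      rw [hN.isSelfAdjoint.adjoint_eq]
      exact hN.isIdempotentElem
    rw [hNN, add_sub_cancel]
  · refine tensorHom_ext fun x v => ?_
    have hv : V (x ⊗ₜ[ℂ] U (adjoint U v)) = V (x ⊗ₜ[ℂ] v) :=
      (DFunLike.congr_fun hVU (x ⊗ₜ[ℂ] adjoint U v)).trans (DFunLike.congr_fun hWU (x ⊗ₜ[ℂ] v))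
    calc V (x ⊗ₜ[ℂ] (v - U (adjoint U v))) = V (x ⊗ₜ[ℂ] v) - V (x ⊗ₜ[ℂ] U (adjoint U v)) := by
          rw [tmul_sub, map_sub]
      _ = 0 := by rw [hv, sub_self]

theorem hasLiftingProperty_mix_conj (A C : Quant) (W : X →L[ℂ] Y) :
    HasLiftingProperty (mix A C) (conj W) := by
  refine ⟨fun {a b} sq => ?_⟩
  obtain ⟨E, K, rfl⟩ := exists_ofDilation_eq a
  obtain ⟨G, H, rfl⟩ := exists_ofDilation_eq b
  have dilations_eq : ofDilation (W ∘L K) = ofDilation (H ∘L assocInvL A C G) := by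
    rw [← ofDilation_comp_conj, sq.w, mix_comp_ofDilation]
  obtain ⟨U, N, hUN, hU, hN⟩ := exists_complementary_comp_lTensor dilations_eq
  obtain ⟨r, hr⟩ := exists_mix_comp_eq_id A C
  let KU : tensor A (tensor C G) →L[ℂ] X := K ∘L U.lTensor A
  let KN : tensor A E →L[ℂ] X := K ∘L N.lTensor A
  refine ⟨⟨⟨ofDilation (KU ∘L assocL A C G) + r ≫ ofDilation KN, ?_, ?_⟩⟩⟩
  · calc mix A C ≫ (ofDilation (KU ∘L assocL A C G) + r ≫ ofDilation KN)
        = ofDilation (KU ∘L assocL A C G ∘L assocInvL A C G) + ofDilation KN := by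
          rw [comp_add, mix_comp_ofDilation, ← Category.assoc, hr, Category.id_comp]
          rfl
      _ = ofDilation K := by
          rw [assocL_comp_assocInvL, comp_id]
          exact ofDilation_comp_lTensor_add hUN
  · calc (ofDilation (KU ∘L assocL A C G) + r ≫ ofDilation KN) ≫ conj W
        = ofDilation ((W ∘L KU) ∘L assocL A C G) + r ≫ ofDilation (W ∘L KN) := by
          rw [add_comp, Category.assoc, ofDilation_comp_conj, ofDilation_comp_conj]
          rfl
      _ = ofDilation (H ∘L assocInvL A C G ∘L assocL A C G) := by
          refine hom_ext ?_
          rw [show W ∘L KU = _ from hU, show W ∘L KN = 0 from hN, linMap_add, linMap_comp,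
            linMap_ofDilation_zero, LinearMap.zero_comp, add_zero]
          rfl
      _ = ofDilation H := by rw [assocInvL_comp_assocL, comp_id]

theorem pureMorphisms_conj (W : X →L[ℂ] Y) : pureMorphisms mixedState (conj W) := by
  rintro _ _ _ ⟨_⟩ A B
  rw [conj_whiskerRight]
  exact hasLiftingProperty_whiskerRight_iff.mpr (hasLiftingProperty_mix_conj A _ _)

theorem linMap_id_ne_zero (A : Quant) : linMap (𝟙 A) ≠ 0 := fun h =>
  one_ne_zero (LinearMap.congr_fun h (1 : A.Op))

theorem linMap_ne_zero_of_mixingMorphisms {f : A ⟶ B} (hf : mixingMorphisms mixedState f) :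
    linMap f ≠ 0 := fun h => by
  have := (hf _ (pureMorphisms_conj (0 : A →L[ℂ] A))).hasLiftingProperty
  have sq : CommSq (𝟙 A) f (conj (0 : A →L[ℂ] A)) (conj (0 : B →L[ℂ] A)) :=
    ⟨hom_ext <| by
      rw [linMap_comp, linMap_comp, linMap_conj_zero, linMap_conj_zero, LinearMap.zero_comp,
        LinearMap.zero_comp]⟩
  refine linMap_id_ne_zero A ?_
  rw [← sq.fac_left, linMap_comp, h, LinearMap.comp_zero]

theorem exists_functional_of_ofDilation_eq_id {V : tensor B G →L[ℂ] B} (h : ofDilation V = 𝟙 B) :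
    ∃ u : G →L[ℂ] ℂ, (∀ y g, V (y ⊗ₜ[ℂ] g) = u g • y) ∧ ∃ g, u g ≠ 0 := by
  obtain ⟨u, -, hu, -⟩ :=
    exists_comp_lTensor_eq_of_ofDilation_eq ((ofDilation_ridL B).trans h.symm)
  have hV (y g) : V (y ⊗ₜ[ℂ] g) = u g • y := (DFunLike.congr_fun hu (y ⊗ₜ[ℂ] g)).symm
  refine ⟨u, hV, ?_⟩
  by_contra! hu0
  have hV0 : V = 0 := tensorHom_ext fun y g => by rw [hV, hu0, zero_smul]; rfl
  exact linMap_id_ne_zero B (by rw [← h, hV0, linMap_ofDilation_zero])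

theorem exists_tmul_eq_of_ofDilation_comp_eq_mix {K : tensor A E →L[ℂ] B}
    {H : tensor B G →L[ℂ] tensor A E} (h : ofDilation K ≫ ofDilation H = mix A E) :
    ∃ T : tensor E G →L[ℂ] E, ∀ x e g,
      H (K (x ⊗ₜ[ℂ] e) ⊗ₜ[ℂ] g) = x ⊗ₜ[ℂ] T (e ⊗ₜ[ℂ] g) := by
  have dilations_eq : ofDilation (.id ℂ (tensor A E)) = ofDilation
      ((H ∘L (K.rTensor G : tensor (tensor A E) G →L[ℂ] tensor B G)) ∘L assocInvL A E G) := by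
    rw [ofDilation_id, ← h, ← mix_comp_ofDilation, ← conj_comp_ofDilation, ← Category.assoc]
    rfl
  obtain ⟨T, -, hT, -⟩ := exists_comp_lTensor_eq_of_ofDilation_eq dilations_eq
  exact ⟨T, fun x e g => (DFunLike.congr_fun hT (x ⊗ₜ[ℂ] (e ⊗ₜ[ℂ] g))).symm⟩

theorem isIso_conj_of_lift {K : tensor A E →L[ℂ] B} (hK : dilationKer K = ⊥)
    {r : B ⟶ tensor A E} (hr : ofDilation K ≫ r = mix A E) (hr' : r ≫ conj K = 𝟙 B) :
    IsIso (conj K) := by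
  obtain ⟨G, H, rfl⟩ := exists_ofDilation_eq r
  obtain ⟨T, hT⟩ := exists_tmul_eq_of_ofDilation_comp_eq_mix hr
  rw [ofDilation_comp_conj] at hr'
  obtain ⟨u, hu, g, hg⟩ := exists_functional_of_ofDilation_eq_id hr'
  -- Lifting gives `K (x ⊗ T (e ⊗ g)) = u g • K (x ⊗ e)` for all `x`; minimality cancels `K`.
  have hTg (e) : T (e ⊗ₜ[ℂ] g) = u g • e := by
    rw [← sub_eq_zero, ← Submodule.mem_bot ℂ, ← hK, mem_dilationKer]
    intro x
    calc K (x ⊗ₜ[ℂ] (T (e ⊗ₜ[ℂ] g) - u g • e))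
        = K (H (K (x ⊗ₜ[ℂ] e) ⊗ₜ[ℂ] g)) - u g • K (x ⊗ₜ[ℂ] e) := by
          rw [hT, tmul_sub, tmul_smul, map_sub, map_smul]
      _ = 0 := sub_eq_zero.mpr (hu _ _)
  let R : B →L[ℂ] tensor A E := (u g)⁻¹ •
    LinearMap.toContinuousLinearMap (H.toLinearMap ∘ₗ (TensorProduct.mk ℂ B G).flip g)
  have hR (y) : R y = (u g)⁻¹ • H (y ⊗ₜ[ℂ] g) := rfl
  refine isIso_conj (R := R) ?_ ?_
  · ext y
    calc K (R y) = (u g)⁻¹ • K (H (y ⊗ₜ[ℂ] g)) := by rw [hR, map_smul]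
      _ = y := (congrArg ((u g)⁻¹ • ·) (hu y g)).trans (inv_smul_smul₀ hg y)
  · refine tensorHom_ext fun x e => ?_
    calc R (K (x ⊗ₜ[ℂ] e)) = (u g)⁻¹ • u g • (x ⊗ₜ[ℂ] e) := by rw [hR, hT, hTg, tmul_smul]
      _ = x ⊗ₜ[ℂ] e := inv_smul_smul₀ hg _

theorem exists_isIso_of_mixingMorphisms {f : A ⟶ B} (hf : mixingMorphisms mixedState f) :
    ∃ (E : Quant) (p : tensor A E ⟶ B), IsIso p ∧ f = mix A E ≫ p := by
  obtain ⟨E, K, rfl, hK⟩ := exists_minimal_ofDilation_eq (linMap_ne_zero_of_mixingMorphisms hf)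
  have := (hf _ (pureMorphisms_conj K)).hasLiftingProperty
  have sq : CommSq (mix A E) (ofDilation K) (conj K) (𝟙 B) := ⟨by rw [Category.comp_id]; rfl⟩
  exact ⟨E, conj K, isIso_conj_of_lift hK sq.fac_left sq.fac_right, rfl⟩

end Quant

/-- In the category of nonzero finite-dimensional Hilbert spaces and completely positive maps, the
mixing morphisms are exactly the simple mixing maps. -/
theorem mainTheorem3 :
    mixingMorphisms Quant.mixedState = simpleMixingMaps Quant.mixedState := by
  refine le_antisymm (fun A B f hf => ?_) (simpleMixingMaps_le_mixingMorphisms _)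
  obtain ⟨E, p, hp, rfl⟩ := Quant.exists_isIso_of_mixingMorphisms hf
  exact ⟨E, p, hp, Category.assoc _ _ _⟩
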